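/- Let $d\in\mathbb N$, let $\mathcal H_R=\mathcal F(L^2(\mathbb R^d,d^dk))$ be the bosonic Fock space, with creation and annihilation operators $a^\dagger(f),a(f)$ and number operator $\widehat N$, let $\omega:\mathbb R^d\to[0,\infty)$ be measurable, and let $h_R=d\Gamma(\omega)$ be the field Hamiltonian, so that $e^{ith_R}=\Gamma(e^{it\omega})$. For $g\in L^2(\mathbb R^d,d^dk)$ put $$v=a^\dagger(g)a(g),\qquad v(t)=e^{ith_R}\,v\,e^{-ith_R},\qquad \overline V_M(t)=\frac1M\sum_{m=1}^M v(t)^{[m]}\quad\text{on }\mathcal H_R^{\otimes M},$$ where $X^{[m]}$ denotes the operator $X$ acting on the $m$-th tensor factor. Then: (i) $v(\widehat N+1)^{-1}$ is an everywhere defined bounded operator, and $\|v(\widehat N+1)^{-1}\|\le 2\|g\|^2$. (ii) Let $\omega_R(\cdot)=\mathrm{Tr}(\rho\,\cdot)$ be the state given by a density matrix $\rho$ on $\mathcal H_R$, and suppose that for some constant $c\in\mathbb R$ $$\omega_R(\widehat N^k)\le c^k\qquad\text{for all }k\in\mathbb N.$$ Let $\omega_{R,M}(\cdot)=\mathrm{Tr}(\rho^{\otimes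 M}\,\cdot)$ be the $M$-fold product state on $\mathcal H_R^{\otimes M}$. Then for all $n\in\mathbb N$ and all $t_1,\dots,t_n\ge0$, the expectations below exist for every $M\ge1$, and $$\sup_{M\ge1}\big|\omega_{R,M}\big(\overline V_M(t_1)\cdots\overline V_M(t_n)\big)\big|\le C_{R,n}\,b_R(t_1)\cdots b_R(t_n)\quad\text{with }C_{R,n}=(2c\|g\|^2)^n,\ b_R(t)=1 .$$ -/

import Mathlib

open scoped TensorProduct InnerProductSpace

noncomputable section

namespace MeanField

/-! ### Unbounded operators -/

section Unbounded

variable {H : Type} [NormedAddCommGroup H] [InnerProductSpace ℂ H]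

/-- The product `B A` of two unbounded operators, on its natural domain
`{x ∈ D(A) | A x ∈ D(B)}`. -/
def opMul (B A : H →ₗ.[ℂ] H) : H →ₗ.[ℂ] H where
  domain := (B.domain.comap A.toFun).map A.domain.subtype
  toFun :=
    { toFun := fun x => B ⟨A ⟨x.1, by
          obtain ⟨y, _, hy⟩ := x.2; rw [← hy]; exact y.2⟩, by
          obtain ⟨x, y, hy, rfl⟩ := x; exact hy⟩
      map_add' := fun x y => by
        rw [← LinearPMap.map_add]; congr 1; apply Subtype.ext
        exact LinearPMap.map_add A ⟨x.1, _⟩ ⟨y.1, _⟩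
      map_smul' := fun c x => by
        rw [RingHom.id_apply, ← LinearPMap.map_smul]; congr 1; apply Subtype.ext
        exact LinearPMap.map_smul A c ⟨x.1, _⟩ }

/-- The identity as an everywhere defined operator. -/
def opOne : H →ₗ.[ℂ] H := LinearMap.id.toPMap ⊤

/-- The ordered product `A₁ A₂ ⋯ Aₙ` of a list of unbounded operators. -/
def opProd (l : List (H →ₗ.[ℂ] H)) : H →ₗ.[ℂ] H := l.foldr opMul opOne

/-- The power `A ^ k` of an unbounded operator. -/
def opPow (A : H →ₗ.[ℂ] H) (k : ℕ) : H →ₗ.[ℂ] H := opProd (List.replicate k A)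

/-- `A` is everywhere defined and bounded with operator norm at most `C`. -/
def IsBoundedBy (A : H →ₗ.[ℂ] H) (C : ℝ) : Prop :=
  ∀ x, ∃ hx : x ∈ A.domain, ‖A ⟨x, hx⟩‖ ≤ C * ‖x‖

end Unbounded

/-! ### Traces, density matrices and expectation values -/

section Trace

variable {H : Type} [NormedAddCommGroup H] [InnerProductSpace ℂ H] [CompleteSpace H]

/-- `T` has trace `z`: along every orthonormal basis the diagonal matrix elements are
(absolutely) summable with sum `z`. For a bounded operator this says exactly that `T` is
of trace class with `Tr T = z`. -/
def HasTrace (T : H → H) (z : ℂ) : Prop :=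
  ∀ (s : Set H) (b : HilbertBasis s ℂ H), HasSum (fun i => ⟪b i, T (b i)⟫_ℂ) z

/-- Density matrices: positive operators of trace one. -/
def IsDensityMatrix (ρ : H →L[ℂ] H) : Prop :=
  ρ.IsPositive ∧ HasTrace ρ 1

/-- The expectation `ω(A) = Tr (ρ A) = Tr (A ρ)` of the (possibly unbounded) operator `A` in the
state with density matrix `ρ` exists and equals `z`: the range of `ρ` is contained in the domain
of `A`, and `A ρ` has trace `z`. -/
def HasExpectation (ρ : H →L[ℂ] H) (A : H →ₗ.[ℂ] H) (z : ℂ) : Prop :=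
  ∃ h : ∀ x, ρ x ∈ A.domain, HasTrace (fun x => A ⟨ρ x, h x⟩) z

end Trace

/-! ### Tensor powers of a Hilbert space -/

/-- A bundled complex Hilbert space (only used for the recursion that defines tensor powers). -/
structure HilbertSpace where
  carrier : Type
  [group : NormedAddCommGroup carrier]
  [inner : InnerProductSpace ℂ carrier]
  [complete : CompleteSpace carrier]

attribute [instance] HilbertSpace.group HilbertSpace.inner HilbertSpace.complete

section TensorPower

variable (H : Type) [NormedAddCommGroup H] [InnerProductSpace ℂ H]

/-- `H^{⊗ 0} = ℂ`, and `H^{⊗ (n+1)}` is the Hilbert space completion of the algebraic tensor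
product of `H` and `H^{⊗ n}`. -/
def tensorPowerAux : ℕ → HilbertSpace
  | 0 => ⟨ℂ⟩
  | n + 1 => ⟨UniformSpace.Completion (H ⊗[ℂ] (tensorPowerAux n).carrier)⟩

/-- The Hilbert space tensor power `H ⊗ ⋯ ⊗ H` (`n` factors). -/
def TensorPower (n : ℕ) : Type := (tensorPowerAux H n).carrier

instance (n : ℕ) : NormedAddCommGroup (TensorPower H n) := (tensorPowerAux H n).group

instance (n : ℕ) : InnerProductSpace ℂ (TensorPower H n) := (tensorPowerAux H n).inner

instance (n : ℕ) : CompleteSpace (TensorPower H n) := (tensorPowerAux H n).complete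

variable {H}

/-- The map `ψ ↦ x ⊗ ψ` from `H^{⊗ n}` to `H^{⊗ (n+1)}`. -/
def tensorCons (x : H) (n : ℕ) : TensorPower H n →L[ℂ] TensorPower H (n + 1) :=
  (UniformSpace.Completion.toComplL (𝕜 := ℂ) (E := H ⊗[ℂ] TensorPower H n)).comp
    (TensorProduct.mkL ℂ H (TensorPower H n) x)

/-- The pure tensor `x₀ ⊗ ⋯ ⊗ x_{n-1}`. -/
def pureTensor : (n : ℕ) → (Fin n → H) → TensorPower H n
  | 0, _ => (1 : ℂ)
  | n + 1, x => tensorCons (x 0) n (pureTensor n (Fin.tail x))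

/-- The tensor power `A ⊗ ⋯ ⊗ A` of a bounded operator. -/
def tensorMap (A : H →L[ℂ] H) : (n : ℕ) → (TensorPower H n →L[ℂ] TensorPower H n)
  | 0 => ContinuousLinearMap.id ℂ _
  | n + 1 => (TensorProduct.mapL A (tensorMap A n)).completion

/-- The operator `A^{[m]} = 1 ⊗ ⋯ ⊗ A ⊗ ⋯ ⊗ 1` on `H^{⊗ n}`, with the unbounded operator `A` on the
`m`-th factor: the closure of its restriction to the span of the pure tensors whose `m`-th factor
lies in the domain of `A`. -/
def siteOp (A : H →ₗ.[ℂ] H) {n : ℕ} (m : Fin n) : TensorPower H n →ₗ.[ℂ] TensorPower H n :=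
  (Submodule.span ℂ {p : TensorPower H n × TensorPower H n |
    ∃ (x : Fin n → H) (h : x m ∈ A.domain),
      p = (pureTensor n x, pureTensor n (Function.update x m (A ⟨x m, h⟩)))}
    ).topologicalClosure.toLinearPMap

/-- The mean field operator `M⁻¹ ∑_m A^{[m]}` on `H^{⊗ M}`. -/
def meanField (A : H →ₗ.[ℂ] H) (M : ℕ) : TensorPower H M →ₗ.[ℂ] TensorPower H M :=
  (M : ℂ)⁻¹ • ∑ m : Fin M, siteOp A m

end TensorPower

/-- The moment bound on the reservoir: for all `n`, all times `t₁, …, tₙ ≥ 0` and all `M ≥ 1`, the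
expectation of `V̄_M(t₁) ⋯ V̄_M(tₙ)` in the state with density matrix `ρM M` exists and is bounded
in modulus by `C n * b t₁ ⋯ b tₙ`. Here `V̄_M(t) = M⁻¹ ∑_m v(t)^{[m]}`. -/
def ReservoirBound {H : Type} [NormedAddCommGroup H] [InnerProductSpace ℂ H]
    (ρM : (M : ℕ) → (TensorPower H M →L[ℂ] TensorPower H M)) (v : ℝ → (H →ₗ.[ℂ] H))
    (C : ℕ → ℝ) (b : ℝ → ℝ) : Prop :=
  ∀ (n : ℕ) (t : Fin n → ℝ), (∀ i, 0 ≤ t i) → ∀ M : ℕ, 1 ≤ M →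
    ∃ z : ℂ, HasExpectation (ρM M) (opProd (List.ofFn fun i => meanField (v (t i)) M)) z ∧
      ‖z‖ ≤ C n * ∏ i, b (t i)

/-! ### Bosonic Fock space -/

section Fock

variable (h : Type) [NormedAddCommGroup h] [InnerProductSpace ℂ h]

/-- The symmetric subspace of `h^{⊗ n}`: the closure of the range of the symmetrization. -/
def symSubspace (n : ℕ) : Submodule ℂ (TensorPower h n) :=
  (Submodule.span ℂ (Set.range fun x : Fin n → h =>
    ∑ σ : Equiv.Perm (Fin n), pureTensor n (x ∘ σ))).topologicalClosure

instance (n : ℕ) : CompleteSpace (symSubspace h n) :=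
  (Submodule.isClosed_topologicalClosure _).completeSpace_coe

/-- The `n`-particle space. -/
abbrev Sector (n : ℕ) : Type := symSubspace h n

/-- The bosonic Fock space over `h`: the Hilbert space direct sum of the `n`-particle spaces. -/
abbrev Fock : Type := lp (Sector h) 2

variable {h}

/-- The operator on Fock space that acts on sequences `(ψₙ)` by `L`, on its maximal domain, the set
of all `ψ` for which `L ψ` is again square summable. -/
def maxOp (L : (∀ n, Sector h n) →ₗ[ℂ] (∀ n, Sector h n)) : Fock h →ₗ.[ℂ] Fock h where
  domain :=
    { carrier := {ψ | Memℓp (L ψ) 2}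
      add_mem' := fun {ψ φ} hψ hφ => by
        simp only [Set.mem_ofPred_eq, lp.coeFn_add, map_add] at *
        exact hψ.add hφ
      zero_mem' := by
        simp only [Set.mem_ofPred_eq, lp.coeFn_zero, map_zero]
        exact zero_memℓp
      smul_mem' := fun c ψ hψ => by
        simp only [Set.mem_ofPred_eq, lp.coeFn_smul, map_smul] at *
        exact hψ.const_smul c }
  toFun :=
    { toFun := fun ψ => ⟨L ψ.1, ψ.2⟩
      map_add' := fun ψ φ => by
        apply Subtype.ext
        exact map_add L _ _
      map_smul' := fun c ψ => by
        apply Subtype.ext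
        exact map_smul L c _ }

/-- `a†(f)` from the `n`-particle to the `(n+1)`-particle space: `ψ ↦ √(n+1) S (f ⊗ ψ)`, where `S`
is the orthogonal projection onto the symmetric tensors. -/
def createSector (f : h) (n : ℕ) : Sector h n →L[ℂ] Sector h (n + 1) :=
  ((Real.sqrt (n + 1) : ℝ) : ℂ) •
    ((symSubspace h (n + 1)).orthogonalProjectionOnto.comp (tensorCons f n)).comp
      (symSubspace h n).subtypeL

/-- `a(f)` from the `(n+1)`-particle to the `n`-particle space, the adjoint of `a†(f)`. -/
def annihilateSector (f : h) (n : ℕ) : Sector h (n + 1) →L[ℂ] Sector h n :=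
  ContinuousLinearMap.adjoint (createSector f n)

/-- The creation operator `a†(f)`. -/
def create (f : h) : Fock h →ₗ.[ℂ] Fock h :=
  maxOp (LinearMap.pi fun n => match n with
    | 0 => 0
    | n + 1 => (createSector f n).toLinearMap ∘ₗ LinearMap.proj n)

/-- The annihilation operator `a(f)`. -/
def annihilate (f : h) : Fock h →ₗ.[ℂ] Fock h :=
  maxOp (LinearMap.pi fun n => (annihilateSector f n).toLinearMap ∘ₗ LinearMap.proj (n + 1))

/-- The number operator, equal to `n` on the `n`-particle space. -/
def number : Fock h →ₗ.[ℂ] Fock h :=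
  maxOp (LinearMap.pi fun n => (n : ℂ) • LinearMap.proj n)

/-- The second quantization `Γ(U)`, equal to `U ⊗ ⋯ ⊗ U` on the `n`-particle space (which that
operator leaves invariant, so that the projection onto the symmetric tensors does nothing). -/
def secondQuantization (U : h →L[ℂ] h) : Fock h →ₗ.[ℂ] Fock h :=
  maxOp (LinearMap.pi fun n =>
    (((symSubspace h n).orthogonalProjectionOnto.comp (tensorMap U n)).comp
      (symSubspace h n).subtypeL).toLinearMap ∘ₗ LinearMap.proj n)

/-- The scattering interaction `a†(g) a(g)`. -/
def scattering (g : h) : Fock h →ₗ.[ℂ] Fock h := opMul (create g) (annihilate g)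

end Fock

/-! ### The free field over `L²(ℝᵈ)` -/

section Field

/-- The one-particle space `L²(ℝᵈ, dᵈk)`. -/
abbrev OneParticle (d : ℕ) : Type :=
  MeasureTheory.Lp ℂ 2 (MeasureTheory.volume : MeasureTheory.Measure (EuclideanSpace ℝ (Fin d)))

variable {d : ℕ}

lemma memLp_phase {θ : EuclideanSpace ℝ (Fin d) → ℝ} (hθ : Measurable θ) (f : OneParticle d) :
    MeasureTheory.MemLp (fun k => Complex.exp (Complex.I * θ k) * f k) 2
      MeasureTheory.volume := by
  refine (MeasureTheory.Lp.memLp f).of_le (AEMeasurable.aestronglyMeasurable ?_) ?_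
  · have := (MeasureTheory.Lp.memLp f).aestronglyMeasurable.aemeasurable
    have h2 : Measurable fun k => Complex.exp (Complex.I * θ k) := by fun_prop
    exact h2.aemeasurable.mul this
  · refine Filter.Eventually.of_forall fun k => ?_
    rw [norm_mul, mul_comm Complex.I, Complex.norm_exp_ofReal_mul_I, one_mul]

/-- Multiplication by the phase `e^{iθ(k)}` on `L²(ℝᵈ)`. -/
def phase (θ : EuclideanSpace ℝ (Fin d) → ℝ) (hθ : Measurable θ) :
    OneParticle d →L[ℂ] OneParticle d :=
  LinearMap.mkContinuous
    { toFun := fun f => (memLp_phase hθ f).toLp _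
      map_add' := fun f g => by
        rw [← MeasureTheory.MemLp.toLp_add, MeasureTheory.MemLp.toLp_eq_toLp_iff]
        filter_upwards [MeasureTheory.Lp.coeFn_add f g] with k hk
        rw [Pi.add_apply, hk, Pi.add_apply, mul_add]
      map_smul' := fun c f => by
        rw [RingHom.id_apply, ← MeasureTheory.MemLp.toLp_const_smul,
          MeasureTheory.MemLp.toLp_eq_toLp_iff]
        filter_upwards [MeasureTheory.Lp.coeFn_smul c f] with k hk
        simp only [hk, Pi.smul_apply, smul_eq_mul]
        ring } 1 fun f => by
      rw [one_mul]
      refine MeasureTheory.Lp.norm_le_norm_of_ae_le ?_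
      filter_upwards [(memLp_phase hθ f).coeFn_toLp] with k hk
      simp only [LinearMap.coe_mk, AddHom.coe_mk]
      rw [hk, norm_mul, mul_comm Complex.I, Complex.norm_exp_ofReal_mul_I, one_mul]

/-- The unitary group `e^{i t h_R} = Γ(e^{i t ω})` generated by the field Hamiltonian
`h_R = dΓ(ω)`. -/
def fieldGroup (ω : EuclideanSpace ℝ (Fin d) → ℝ) (hω : Measurable ω) (t : ℝ) :
    Fock (OneParticle d) →ₗ.[ℂ] Fock (OneParticle d) :=
  secondQuantization (phase (fun k => t * ω k) (hω.const_mul t))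

/-- The free Heisenberg evolution `A(t) = e^{i t h_R} A e^{-i t h_R}`. -/
def heisenberg (ω : EuclideanSpace ℝ (Fin d) → ℝ) (hω : Measurable ω)
    (A : Fock (OneParticle d) →ₗ.[ℂ] Fock (OneParticle d)) (t : ℝ) :
    Fock (OneParticle d) →ₗ.[ℂ] Fock (OneParticle d) :=
  opMul (fieldGroup ω hω t) (opMul A (fieldGroup ω hω (-t)))

end Field

end MeanField

end

/-! Both parts rest on one fact: `a†(g) a(g)` preserves the particle number and has norm at most `n
‖g‖²` on the `n`-particle space, since creation and annihilation between neighbouring sectors each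
contribute `√n ‖g‖`. Dividing by `n + 1` gives (i), even without the factor 2.

For (ii), the moment bounds force `ρ` to live on at most `c` particles
(`apply_eq_zero_of_moments_le`): the weight of `ρ` on an `n`-particle state is at most `(c/n)^k` for
every `k`, hence zero when `n > c`. There each `v(t)` is bounded by `c ‖g‖²`, because `Γ` of a
contraction is a contraction preserving particle number. Averaging over sites keeps this bound
uniformly in `M`, and the expectation of a product of bounded operators is at most the product of
their norms.

The remaining work concerns domains and traces. Truncations in particle number serve as cutoffs
(`IsCutoff`); they show that each site operator is closable (`IsCutoff.mem_graph_siteOp`) and agrees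
with a bounded operator on the truncated tensor power, an invariant subspace containing the range of
`ρ^{⊗M}`. Traces are computed from a decomposition of `ρ` into rank one operators (`IsMixture`),
which passes to tensor powers and gives the same value along every orthonormal basis. -/

noncomputable section

namespace MeanField

/-! ### Unbounded operators through their graphs -/

section Graph

variable {H : Type} [NormedAddCommGroup H] [InnerProductSpace ℂ H]

/-- Graphs carry domain and value together, so natural domains of products reduce to the existence
of an intermediate vector. -/
lemma mem_graph_opMul {A B : H →ₗ.[ℂ] H} {x z : H} :
    (x, z) ∈ (opMul B A).graph ↔ ∃ y, (x, y) ∈ A.graph ∧ (y, z) ∈ B.graph := by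
  simp only [LinearPMap.mem_graph_iff]
  constructor
  · rintro ⟨⟨w, ⟨u, hu, rfl⟩⟩, rfl, rfl⟩
    exact ⟨A u, ⟨u, rfl, rfl⟩, ⟨⟨A u, hu⟩, rfl, rfl⟩⟩
  · rintro ⟨y, ⟨u, rfl, rfl⟩, ⟨w, hw, rfl⟩⟩
    refine ⟨⟨u.1, ⟨u, ?_, rfl⟩⟩, rfl, ?_⟩
    · have : A u ∈ B.domain := hw ▸ w.2
      exact this
    · obtain ⟨w, hw'⟩ := w
      obtain rfl : w = A u := hw
      rfl

lemma mem_graph_opOne {x y : H} : (x, y) ∈ (opOne : H →ₗ.[ℂ] H).graph ↔ y = x := by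
  simp only [LinearPMap.mem_graph_iff]
  constructor
  · rintro ⟨u, rfl, rfl⟩
    rfl
  · rintro rfl
    exact ⟨⟨y, trivial⟩, rfl, rfl⟩

lemma mem_graph_add {A B : H →ₗ.[ℂ] H} {x y z : H} (hA : (x, y) ∈ A.graph)
    (hB : (x, z) ∈ B.graph) : (x, y + z) ∈ (A + B).graph := by
  rw [LinearPMap.mem_graph_iff] at *
  obtain ⟨u, rfl, rfl⟩ := hA
  obtain ⟨⟨w, hw'⟩, hw, rfl⟩ := hB
  obtain rfl : w = u := hw
  exact ⟨⟨u, u.2, hw'⟩, rfl, rfl⟩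

lemma mem_graph_smul {A : H →ₗ.[ℂ] H} {x y : H} (c : ℂ) (hA : (x, y) ∈ A.graph) :
    (x, c • y) ∈ (c • A).graph := by
  rw [LinearPMap.mem_graph_iff] at *
  obtain ⟨u, rfl, rfl⟩ := hA
  exact ⟨u, rfl, rfl⟩

lemma mem_graph_sum {ι : Type*} (s : Finset ι) {A : ι → H →ₗ.[ℂ] H} {x : H} {y : ι → H}
    (h : ∀ i ∈ s, (x, y i) ∈ (A i).graph) : (x, ∑ i ∈ s, y i) ∈ (∑ i ∈ s, A i).graph := by
  classical
  induction s using Finset.induction_on with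
  | empty =>
    simp only [Finset.sum_empty]
    exact (LinearPMap.mem_graph_iff _).2 ⟨⟨x, trivial⟩, rfl, rfl⟩
  | insert i s hi ih =>
    rw [Finset.sum_insert hi, Finset.sum_insert hi]
    exact mem_graph_add (h i (Finset.mem_insert_self _ _))
      (ih fun j hj => h j (Finset.mem_insert_of_mem hj))

lemma exists_eq_of_mem_graph {A : H →ₗ.[ℂ] H} {x y : H} (h : (x, y) ∈ A.graph) :
    ∃ hx : x ∈ A.domain, A ⟨x, hx⟩ = y := by
  obtain ⟨u, rfl, rfl⟩ := (LinearPMap.mem_graph_iff _).1 h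
  exact ⟨u.2, rfl⟩

/-- If bounded operators `T i` preserve a subspace `S` on which the unbounded operators `A i` are
defined and agree with them, then the same holds for the ordered products. -/
lemma mem_graph_opProd_ofFn {S : Submodule ℂ H} : ∀ {n : ℕ} {A : Fin n → H →ₗ.[ℂ] H}
    {T : Fin n → H →L[ℂ] H}, (∀ i, ∀ x ∈ S, (x, T i x) ∈ (A i).graph) →
    (∀ i, ∀ x ∈ S, T i x ∈ S) → ∀ x ∈ S,
    (x, (List.ofFn T).prod x) ∈ (opProd (List.ofFn A)).graph ∧ (List.ofFn T).prod x ∈ S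
  | 0, _, _, _, _, x, hx => by
    exact ⟨by simpa only [List.ofFn_zero] using! mem_graph_opOne.2 rfl, hx⟩
  | n + 1, A, T, hA, hT, x, hx => by
    obtain ⟨h₁, h₂⟩ := mem_graph_opProd_ofFn (A := fun i => A i.succ) (T := fun i => T i.succ)
      (fun i => hA i.succ) (fun i => hT i.succ) x hx
    simp only [List.ofFn_succ, List.prod_cons, opProd, List.foldr_cons]
    exact ⟨mem_graph_opMul.2 ⟨_, h₁, hA 0 _ h₂⟩, hT 0 _ h₂⟩

end Graph

/-! ### Density matrices as mixtures, traces and tensor products -/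

section Mixture

variable {H K : Type} [NormedAddCommGroup H] [InnerProductSpace ℂ H]
  [NormedAddCommGroup K] [InnerProductSpace ℂ K] {ι κ : Type}

/-- `ρ = ∑ₖ |uₖ⟩⟨uₖ|` with `∑ₖ ‖uₖ‖² = 1`. -/
structure IsMixture (ρ : H →L[ℂ] H) (u : ι → H) : Prop where
  hasSum_norm_sq : HasSum (fun k => ‖u k‖ ^ 2) 1
  hasSum_apply : ∀ x, HasSum (fun k => ⟪u k, x⟫_ℂ • u k) (ρ x)

lemma hasSum_norm_inner_sq (b : HilbertBasis ι ℂ H) (x : H) :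
    HasSum (fun i => ‖⟪b i, x⟫_ℂ‖ ^ 2) (‖x‖ ^ 2) := by
  have h := (b.hasSum_inner_mul_inner x x).mapL Complex.reCLM
  simp only [Complex.reCLM_apply] at h
  convert! h using 1
  · ext i
    rw [← inner_conj_symm, Complex.mul_conj', Complex.norm_conj]
    norm_cast
  · exact (inner_self_eq_norm_sq (𝕜 := ℂ) x).symm

lemma summable_prod_norm_inner_sq (b : HilbertBasis ι ℂ H) {u : κ → H}
    (hu : Summable fun k => ‖u k‖ ^ 2) :
    Summable fun p : κ × ι => ‖⟪b p.2, u p.1⟫_ℂ‖ ^ 2 := by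
  rw [summable_prod_of_nonneg fun _ => by positivity]
  refine ⟨fun k => (hasSum_norm_inner_sq b (u k)).summable, ?_⟩
  simpa only [(hasSum_norm_inner_sq b _).tsum_eq] using hu

lemma IsMixture.summable_norm_apply {ρ : H →L[ℂ] H} {u : ι → H} (h : IsMixture ρ u)
    (T : H →L[ℂ] H) : Summable fun k => ‖T (u k)‖ ^ 2 := by
  refine .of_nonneg_of_le (fun _ => by positivity) (fun k => ?_)
    (h.hasSum_norm_sq.summable.mul_left (‖T‖ ^ 2))
  rw [← mul_pow]
  gcongr
  exact T.le_opNorm _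

lemma IsMixture.summable_inner {ρ : H →L[ℂ] H} {u : ι → H} (h : IsMixture ρ u)
    (T : H →L[ℂ] H) : Summable fun k => ‖⟪u k, T (u k)⟫_ℂ‖ := by
  refine .of_nonneg_of_le (fun _ => by positivity) (fun k => ?_)
    (h.hasSum_norm_sq.summable.mul_left ‖T‖)
  calc ‖⟪u k, T (u k)⟫_ℂ‖ ≤ ‖u k‖ * ‖T (u k)‖ := norm_inner_le_norm _ _
    _ ≤ ‖u k‖ * (‖T‖ * ‖u k‖) := by gcongr; exact T.le_opNorm _
    _ = ‖T‖ * ‖u k‖ ^ 2 := by ring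

lemma IsMixture.norm_tsum_inner_le {ρ : H →L[ℂ] H} {u : ι → H} (h : IsMixture ρ u)
    (T : H →L[ℂ] H) : ‖∑' k, ⟪u k, T (u k)⟫_ℂ‖ ≤ ‖T‖ := by
  refine (norm_tsum_le_tsum_norm (h.summable_inner T)).trans ?_
  have h' := h.hasSum_norm_sq.mul_left ‖T‖
  rw [← mul_one ‖T‖, ← h'.tsum_eq]
  refine (h.summable_inner T).tsum_le_tsum (fun k => ?_) h'.summable
  calc ‖⟪u k, T (u k)⟫_ℂ‖ ≤ ‖u k‖ * ‖T (u k)‖ := norm_inner_le_norm _ _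
    _ ≤ ‖u k‖ * (‖T‖ * ‖u k‖) := by gcongr; exact T.le_opNorm _
    _ = ‖T‖ * ‖u k‖ ^ 2 := by ring

/-- The double series of `⟪uₖ, bᵢ⟫ ⟪bᵢ, T uₖ⟫` converges absolutely. Summing over `i` first gives
the basis-independent value, summing over `k` first gives the diagonal elements of `T ρ`. -/
lemma IsMixture.hasTrace [CompleteSpace H] {ρ : H →L[ℂ] H} {u : ι → H} (h : IsMixture ρ u)
    (T : H →L[ℂ] H) : HasTrace (fun x => T (ρ x)) (∑' k, ⟪u k, T (u k)⟫_ℂ) := by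
  intro s b
  have hsum : Summable fun p : ι × s => ⟪u p.1, b p.2⟫_ℂ * ⟪b p.2, T (u p.1)⟫_ℂ := by
    refine .of_norm_bounded ((summable_prod_norm_inner_sq b h.hasSum_norm_sq.summable).add
      (summable_prod_norm_inner_sq b (h.summable_norm_apply T))) fun p => ?_
    rw [norm_mul, norm_inner_symm]
    -- Here `a b ≤ a² + b²`; both squares are summable over pairs by Parseval.
    nlinarith [sq_nonneg (‖⟪b p.2, u p.1⟫_ℂ‖ - ‖⟪b p.2, T (u p.1)⟫_ℂ‖),
      sq_nonneg ‖⟪b p.2, u p.1⟫_ℂ‖, sq_nonneg ‖⟪b p.2, T (u p.1)⟫_ℂ‖]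
  have h₁ := hsum.hasSum.prod_fiberwise fun k => b.hasSum_inner_mul_inner (u k) (T (u k))
  rw [h₁.tsum_eq]
  refine ((Equiv.prodComm s ι).hasSum_iff.2 hsum.hasSum).prod_fiberwise fun i => ?_
  have h₂ := ((h.hasSum_apply (b i)).mapL T).mapL (innerSL ℂ (b i))
  simpa [inner_smul_right] using h₂

lemma exists_symmetric_sqrt [CompleteSpace H] {ρ : H →L[ℂ] H} (hρ : ρ.IsPositive) :
    ∃ R : H →L[ℂ] H, (∀ x y, ⟪R x, y⟫_ℂ = ⟪x, R y⟫_ℂ) ∧ ∀ x, R (R x) = ρ x := by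
  have h0 : 0 ≤ ρ := (ContinuousLinearMap.nonneg_iff_isPositive ρ).2 hρ
  refine ⟨CFC.sqrt ρ, ((ContinuousLinearMap.nonneg_iff_isPositive _).1
    (CFC.sqrt_nonneg ρ)).isSymmetric, fun x => ?_⟩
  conv_rhs => rw [← CFC.sqrt_mul_sqrt_self ρ h0]
  rfl

/-- With `R² = ρ` and `R` symmetric, `⟪x, ρ x⟫ = ‖R x‖²`. -/
lemma apply_eq_zero_of_inner_eq_zero [CompleteSpace H] {ρ : H →L[ℂ] H} (hρ : ρ.IsPositive)
    {x : H} (hx : ⟪x, ρ x⟫_ℂ = 0) : ρ x = 0 := by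
  obtain ⟨R, hsym, hRx⟩ := exists_symmetric_sqrt hρ
  rw [← hRx, ← hsym, inner_self_eq_zero] at hx
  rw [← hRx, hx, map_zero]

/-- No spectral decomposition is needed: the images of any Hilbert basis under `√ρ` will do, and
they need not be orthogonal. -/
lemma exists_isMixture [CompleteSpace H] {ρ : H →L[ℂ] H} (hρ : IsDensityMatrix ρ) :
    ∃ (ι : Type) (u : ι → H), IsMixture ρ u := by
  obtain ⟨hpos, htr⟩ := hρ
  obtain ⟨s, b, -⟩ := exists_hilbertBasis ℂ H
  obtain ⟨R, hsym, hRx⟩ := exists_symmetric_sqrt hpos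
  refine ⟨s, fun i => R (b i), ⟨?_, fun x => ?_⟩⟩
  · have h := (htr s b).mapL Complex.reCLM
    simp only [Complex.reCLM_apply, Complex.one_re] at h
    convert! h using 2 with i
    rw [← hRx, ← hsym]
    exact (inner_self_eq_norm_sq (𝕜 := ℂ) _).symm
  · have h := (b.hasSum_repr (R x)).mapL (R)
    simpa [b.repr_apply_apply, hRx, hsym] using h

lemma completion_tensor_eq_top {S : Submodule ℂ (UniformSpace.Completion (H ⊗[ℂ] K))}
    (hS : IsClosed (S : Set (UniformSpace.Completion (H ⊗[ℂ] K))))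
    (h : ∀ (x : H) (y : K), ((x ⊗ₜ[ℂ] y : H ⊗[ℂ] K) : UniformSpace.Completion (H ⊗[ℂ] K)) ∈ S) :
    S = ⊤ := by
  refine (Submodule.eq_top_iff').2 fun z => ?_
  refine UniformSpace.Completion.induction_on z hS fun a => ?_
  induction a using TensorProduct.induction_on with
  | zero => exact UniformSpace.Completion.coe_zero (α := H ⊗[ℂ] K) ▸ S.zero_mem
  | tmul x y => exact h x y
  | add a b ha hb =>
    rw [UniformSpace.Completion.coe_add]
    exact S.add_mem ha hb

lemma completion_tensor_ext {G : Type*} [NormedAddCommGroup G] [NormedSpace ℂ G]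
    {f g : UniformSpace.Completion (H ⊗[ℂ] K) →L[ℂ] G}
    (h : ∀ (x : H) (y : K), f ((x ⊗ₜ[ℂ] y : H ⊗[ℂ] K) : UniformSpace.Completion (H ⊗[ℂ] K)) =
      g ((x ⊗ₜ[ℂ] y : H ⊗[ℂ] K) : UniformSpace.Completion (H ⊗[ℂ] K))) : f = g := by
  have hS := completion_tensor_eq_top
    (S := LinearMap.eqLocus f.toLinearMap g.toLinearMap) (isClosed_eq f.continuous g.continuous) h
  ext x
  exact (hS ▸ Submodule.mem_top : x ∈ LinearMap.eqLocus f.toLinearMap g.toLinearMap)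

/-- The rank one operators of the product vectors are summable in norm, so their sum is bounded and
can be compared with the tensor product on pure tensors alone, where it factorizes. -/
lemma IsMixture.tensor {ρ : H →L[ℂ] H} {σ : K →L[ℂ] K} {u : ι → H} {w : κ → K}
    (hρ : IsMixture ρ u) (hσ : IsMixture σ w) :
    IsMixture (TensorProduct.mapL ρ σ).completion (fun p : ι × κ =>
      ((u p.1 ⊗ₜ[ℂ] w p.2 : H ⊗[ℂ] K) : UniformSpace.Completion (H ⊗[ℂ] K))) := by
  set v := fun p : ι × κ =>
      ((u p.1 ⊗ₜ[ℂ] w p.2 : H ⊗[ℂ] K) : UniformSpace.Completion (H ⊗[ℂ] K)) with hv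
  have hnorm : ∀ p, ‖v p‖ ^ 2 = ‖u p.1‖ ^ 2 * ‖w p.2‖ ^ 2 := fun p => by
    rw [hv, UniformSpace.Completion.norm_coe, TensorProduct.norm_tmul, mul_pow]
  have hsummable : Summable fun p => ‖v p‖ ^ 2 := by
    simp only [hnorm]
    exact hρ.hasSum_norm_sq.summable.mul_of_nonneg hσ.hasSum_norm_sq.summable
      (fun _ => by positivity) (fun _ => by positivity)
  refine ⟨?_, ?_⟩
  · have h := hρ.hasSum_norm_sq.mul hσ.hasSum_norm_sq (by simpa only [hnorm] using hsummable)
    simpa only [hnorm, mul_one] using h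
  · let F : ι × κ → _ := fun p => (innerSL ℂ (v p)).smulRight (v p)
    have hF : Summable F := by
      refine .of_norm_bounded hsummable fun p => ?_
      rw [ContinuousLinearMap.norm_smulRight_apply, innerSL_apply_norm, sq]
    have hFx : ∀ x, HasSum (fun p => ⟪v p, x⟫_ℂ • v p) ((∑' p, F p) x) := fun x =>
      (hF.hasSum.mapL (ContinuousLinearMap.apply ℂ _ x))
    suffices hEq : ∑' p, F p = (TensorProduct.mapL ρ σ).completion from hEq ▸ hFx
    refine completion_tensor_ext fun x y => ?_
    have h₁ : ∀ k, HasSum (fun l => ⟪v (k, l), ((x ⊗ₜ[ℂ] y : H ⊗[ℂ] K) :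
        UniformSpace.Completion (H ⊗[ℂ] K))⟫_ℂ • v (k, l))
        (((⟪u k, x⟫_ℂ • u k) ⊗ₜ[ℂ] σ y : H ⊗[ℂ] K) : UniformSpace.Completion (H ⊗[ℂ] K)) := by
      intro k
      have h := ((hσ.hasSum_apply y).mapL (TensorProduct.mkL ℂ H K (⟪u k, x⟫_ℂ • u k))).mapL
        (UniformSpace.Completion.toComplL (𝕜 := ℂ))
      convert! h using 2 with l
      simp [hv, UniformSpace.Completion.inner_coe, smul_smul, mul_comm]
    have h₂ := (hFx ((x ⊗ₜ[ℂ] y : H ⊗[ℂ] K) :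
        UniformSpace.Completion (H ⊗[ℂ] K))).prod_fiberwise h₁
    have h₃ := ((hρ.hasSum_apply x).mapL ((TensorProduct.mkL ℂ H K).flip (σ y))).mapL
        (UniformSpace.Completion.toComplL (𝕜 := ℂ))
    exact h₂.unique (by simpa [← TensorProduct.smul_tmul'] using h₃)

end Mixture

/-! ### Product operators on tensor powers -/

section TensorPowerMaps

variable {H : Type} [NormedAddCommGroup H] [InnerProductSpace ℂ H]

/-- A closed subspace that contains all pure tensors is the whole tensor power. -/
lemma tensorPower_eq_top : ∀ {n : ℕ} {S : Submodule ℂ (TensorPower H n)},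
    IsClosed (S : Set (TensorPower H n)) → (∀ x : Fin n → H, pureTensor n x ∈ S) → S = ⊤
  | 0, S, _, h => by
    refine Submodule.eq_top_iff'.2 fun z => ?_
    have h1 := S.smul_mem (show ℂ from z) (h ![])
    have hz : (show ℂ from z) • pureTensor 0 (![] : Fin 0 → H) = z :=
      mul_one (show ℂ from z)
    rwa [hz] at h1
  | n + 1, S, hS, h => by
    refine completion_tensor_eq_top (H := H) (K := TensorPower H n) hS fun x y => ?_
    have hx : S.comap (tensorCons x n).toLinearMap = ⊤ := by
      refine tensorPower_eq_top (hS.preimage (tensorCons x n).continuous) fun z => ?_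
      have := h (Fin.cons x z)
      exact this
    exact (hx ▸ Submodule.mem_top : y ∈ S.comap (tensorCons x n).toLinearMap)

lemma tensorPower_ext {n : ℕ} {G : Type*} [NormedAddCommGroup G] [NormedSpace ℂ G]
    {f g : TensorPower H n →L[ℂ] G} (h : ∀ x, f (pureTensor n x) = g (pureTensor n x)) :
    f = g := by
  have hS := tensorPower_eq_top
    (S := LinearMap.eqLocus f.toLinearMap g.toLinearMap) (isClosed_eq f.continuous g.continuous) h
  ext x
  exact (hS ▸ Submodule.mem_top : x ∈ LinearMap.eqLocus f.toLinearMap g.toLinearMap)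

lemma continuous_pureTensor : ∀ n : ℕ, Continuous (pureTensor (H := H) n)
  | 0 => continuous_const
  | n + 1 => by
    have h : Continuous fun x : Fin (n + 1) → H =>
        (x 0, pureTensor n (Fin.tail x)) :=
      (continuous_apply 0).prodMk ((continuous_pureTensor n).comp
        (continuous_pi fun i => continuous_apply i.succ))
    exact (UniformSpace.Completion.toComplL (𝕜 := ℂ)
      (E := H ⊗[ℂ] TensorPower H n)).continuous.comp (TensorProduct.continuous_tmul.comp h)

/-- The operator `A₀ ⊗ ⋯ ⊗ A_{n-1}`. -/
def productMap : (n : ℕ) → (Fin n → H →L[ℂ] H) → (TensorPower H n →L[ℂ] TensorPower H n)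
  | 0, _ => ContinuousLinearMap.id ℂ _
  | n + 1, A => (TensorProduct.mapL (A 0) (productMap n (Fin.tail A))).completion

lemma productMap_pureTensor : ∀ (n : ℕ) (A : Fin n → H →L[ℂ] H) (x : Fin n → H),
    productMap n A (pureTensor n x) = pureTensor n fun i => A i (x i)
  | 0, _, _ => rfl
  | n + 1, A, x => by
    have h := productMap_pureTensor n (Fin.tail A) (Fin.tail x)
    have h' := ContinuousLinearMap.completion_apply_coe
      (TensorProduct.mapL (A 0) (productMap n (Fin.tail A)))
      (x 0 ⊗ₜ[ℂ] pureTensor n (Fin.tail x))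
    rw [TensorProduct.mapL_tmul, h] at h'
    exact h'

lemma norm_completion_le {E F : Type*} [NormedAddCommGroup E] [NormedSpace ℂ E]
    [NormedAddCommGroup F] [NormedSpace ℂ F] (f : E →L[ℂ] F) : ‖f.completion‖ ≤ ‖f‖ := by
  refine f.completion.opNorm_le_bound (norm_nonneg _) fun x => ?_
  refine UniformSpace.Completion.induction_on x
    (isClosed_le f.completion.continuous.norm (continuous_const.mul continuous_norm)) fun a => ?_
  rw [ContinuousLinearMap.completion_apply_coe, UniformSpace.Completion.norm_coe,
    UniformSpace.Completion.norm_coe]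
  exact f.le_opNorm a

lemma norm_productMap_le : ∀ (n : ℕ) (A : Fin n → H →L[ℂ] H),
    ‖productMap n A‖ ≤ ∏ i, ‖A i‖
  | 0, _ => by
    rw [Finset.univ_eq_empty, Finset.prod_empty]
    exact ContinuousLinearMap.norm_id_le
  | n + 1, A => by
    rw [Fin.prod_univ_succ]
    refine (norm_completion_le (TensorProduct.mapL (A 0) (productMap n (Fin.tail A)))).trans ?_
    refine (TensorProduct.norm_mapL_le _ _).trans ?_
    exact mul_le_mul_of_nonneg_left (norm_productMap_le n (Fin.tail A)) (norm_nonneg _)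

lemma productMap_const (A : H →L[ℂ] H) : ∀ n : ℕ, productMap n (fun _ => A) = tensorMap A n
  | 0 => rfl
  | n + 1 => by
    have h := productMap_const A n
    rw [tensorMap, ← h]
    rfl

lemma productMap_comp (n : ℕ) (A B : Fin n → H →L[ℂ] H) (ψ : TensorPower H n) :
    productMap n A (productMap n B ψ) = productMap n (fun i => (A i).comp (B i)) ψ := by
  have h : (productMap n A).comp (productMap n B) = productMap n (fun i => (A i).comp (B i)) :=
    tensorPower_ext fun x => by simp [productMap_pureTensor]
  exact congrArg (fun f => f ψ) h

lemma isMixture_one : IsMixture (ContinuousLinearMap.id ℂ ℂ) (fun _ : Unit => 1) := by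
  refine ⟨?_, fun x => ?_⟩
  · simp
  · simp

lemma IsMixture.tensorMap {ι : Type} {ρ : H →L[ℂ] H} {u : ι → H} (h : IsMixture ρ u) :
    ∀ n : ℕ, ∃ (κ : Type) (w : κ → TensorPower H n), IsMixture (tensorMap ρ n) w
  | 0 => ⟨Unit, _, isMixture_one⟩
  | n + 1 => by
    obtain ⟨κ, w, hw⟩ := h.tensorMap n
    exact ⟨ι × κ, _, h.tensor hw⟩

/-- The bounded operator `A` acting on the `m`-th tensor factor. -/
def siteMap (A : H →L[ℂ] H) {n : ℕ} (m : Fin n) : TensorPower H n →L[ℂ] TensorPower H n :=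
  productMap n (Function.update (fun _ => ContinuousLinearMap.id ℂ H) m A)

lemma siteMap_pureTensor (A : H →L[ℂ] H) {n : ℕ} (m : Fin n) (x : Fin n → H) :
    siteMap A m (pureTensor n x) = pureTensor n (Function.update x m (A (x m))) := by
  rw [siteMap, productMap_pureTensor]
  congr 1
  ext i
  rcases eq_or_ne i m with rfl | hi
  · simp
  · simp [hi]

lemma norm_siteMap_le (A : H →L[ℂ] H) {n : ℕ} (m : Fin n) : ‖siteMap A m‖ ≤ ‖A‖ := by
  refine (norm_productMap_le _ _).trans ?_
  rw [← Finset.mul_prod_erase _ _ (Finset.mem_univ m), Function.update_self]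
  refine mul_le_of_le_one_right (norm_nonneg _) ?_
  refine Finset.prod_le_one (fun _ _ => norm_nonneg _) fun i hi => ?_
  rw [Function.update_of_ne (Finset.ne_of_mem_erase hi)]
  exact ContinuousLinearMap.norm_id_le

lemma siteMap_tensorMap {A P : H →L[ℂ] H} (h : A.comp P = P) {n : ℕ} (m : Fin n)
    (ψ : TensorPower H n) : siteMap A m (tensorMap P n ψ) = tensorMap P n ψ := by
  rw [← productMap_const, siteMap, productMap_comp]
  congr 2
  ext1 i
  rcases eq_or_ne i m with rfl | hi
  · simpa using h
  · simp [hi]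

/-- In either order the product has `W` at site `m` and `P` at all other sites. -/
lemma tensorMap_siteMap {P W : H →L[ℂ] H} (h₁ : P.comp W = W) (h₂ : W.comp P = W)
    {n : ℕ} (m : Fin n) (ψ : TensorPower H n) :
    tensorMap P n (siteMap W m ψ) = siteMap W m (tensorMap P n ψ) := by
  rw [← productMap_const, siteMap, productMap_comp, productMap_comp]
  congr 2
  ext1 i
  rcases eq_or_ne i m with rfl | hi
  · simp [h₁, h₂]
  · simp [hi]

lemma tensorMap_tensorMap (A B : H →L[ℂ] H) (n : ℕ) (ψ : TensorPower H n) :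
    tensorMap A n (tensorMap B n ψ) = tensorMap (A.comp B) n ψ := by
  rw [← productMap_const, ← productMap_const, ← productMap_const, productMap_comp]

lemma norm_tensorMap_le_one {A : H →L[ℂ] H} (hA : ‖A‖ ≤ 1) (n : ℕ) : ‖tensorMap A n‖ ≤ 1 := by
  rw [← productMap_const]
  exact (norm_productMap_le _ _).trans (Finset.prod_le_one (fun _ _ => norm_nonneg _) fun _ _ => hA)

/-- A family of contractions is equicontinuous, so the vectors where convergence holds form a closed
subspace; pure tensors belong to it by continuity of `pureTensor`. -/
lemma tendsto_siteMap {P : ℕ → H →L[ℂ] H} (hP : ∀ k, ‖P k‖ ≤ 1)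
    (hlim : ∀ x, Filter.Tendsto (fun k => P k x) Filter.atTop (nhds x)) {n : ℕ} (m : Fin n)
    (ψ : TensorPower H n) :
    Filter.Tendsto (fun k => siteMap (P k) m ψ) Filter.atTop (nhds ψ) := by
  let S : Submodule ℂ (TensorPower H n) :=
    { carrier := {ψ | Filter.Tendsto (fun k => siteMap (P k) m ψ) Filter.atTop (nhds ψ)}
      add_mem' := fun {a b} ha hb => by
        simpa only [Set.mem_ofPred_eq, map_add] using Filter.Tendsto.add ha hb
      zero_mem' := by simp
      smul_mem' := fun c a ha => by
        simpa only [Set.mem_ofPred_eq, map_smul] using Filter.Tendsto.const_smul ha c }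
  have hclosed : IsClosed (S : Set (TensorPower H n)) := by
    refine Equicontinuous.isClosed_setOfPred_tendsto (F := fun k => siteMap (P k) m) (f := id)
      (LipschitzWith.uniformEquicontinuous _ 1 fun k => ?_).equicontinuous continuous_id
    exact (siteMap (P k) m).lipschitz.weaken ((norm_siteMap_le _ m).trans (hP k))
  have hS := tensorPower_eq_top hclosed fun x => by
    change Filter.Tendsto (fun k => siteMap (P k) m (pureTensor n x)) _ _
    simp only [siteMap_pureTensor]
    have h : Filter.Tendsto (fun k => Function.update x m (P k (x m))) Filter.atTop
        (nhds (Function.update x m (x m))) :=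
      (tendsto_const_nhds (x := x)).update m (hlim (x m))
    rw [Function.update_eq_self] at h
    exact ((continuous_pureTensor n).tendsto x).comp h
  exact (hS ▸ Submodule.mem_top : ψ ∈ S)

end TensorPowerMaps

/-! ### Closability of site operators and mean fields -/

section SiteOp

variable {H : Type} [NormedAddCommGroup H] [InnerProductSpace ℂ H]

/-- Cutoffs for an unbounded operator `A`: contractions `P k` that tend strongly to the identity,
such that `A (P k)` and `(P k) A` are given by one bounded operator `W k`. -/
structure IsCutoff (A : H →ₗ.[ℂ] H) (P W : ℕ → H →L[ℂ] H) : Prop where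
  norm_le : ∀ k, ‖P k‖ ≤ 1
  tendsto : ∀ x, Filter.Tendsto (fun k => P k x) Filter.atTop (nhds x)
  mem_graph : ∀ k x, (P k x, W k x) ∈ A.graph
  apply_eq : ∀ k x y, (x, y) ∈ A.graph → P k y = W k x

/-- The cutoffs are used twice: `P A ⊆ W` makes the closure single-valued, and `A P = W` places the
truncated vectors in its domain. -/
lemma IsCutoff.mem_graph_siteOp {A : H →ₗ.[ℂ] H} {P W : ℕ → H →L[ℂ] H} (h : IsCutoff A P W)
    {n : ℕ} (m : Fin n) (k : ℕ) (ψ : TensorPower H n) :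
    (siteMap (P k) m ψ, siteMap (W k) m ψ) ∈ (siteOp A m).graph := by
  set G : Submodule ℂ (TensorPower H n × TensorPower H n) :=
    Submodule.span ℂ {p : TensorPower H n × TensorPower H n |
      ∃ (x : Fin n → H) (h : x m ∈ A.domain),
        p = (pureTensor n x, pureTensor n (Function.update x m (A ⟨x m, h⟩)))} with hG
  -- This relation is closed and linear, so it passes from the generating pairs to the closure.
  have hcut : ∀ j, ∀ p ∈ G.topologicalClosure, siteMap (P j) m p.2 = siteMap (W j) m p.1 := by
    intro j
    let S := LinearMap.eqLocus
      ((siteMap (P j) m).comp (ContinuousLinearMap.snd ℂ (TensorPower H n) _)).toLinearMap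
      ((siteMap (W j) m).comp (ContinuousLinearMap.fst ℂ _ (TensorPower H n))).toLinearMap
    have hS : G.topologicalClosure ≤ S := by
      refine Submodule.topologicalClosure_minimal _ (Submodule.span_le.2 ?_)
        (isClosed_eq (ContinuousLinearMap.continuous _) (ContinuousLinearMap.continuous _))
      rintro p ⟨x, hx, rfl⟩
      change siteMap (P j) m (pureTensor n _) = siteMap (W j) m (pureTensor n _)
      rw [siteMap_pureTensor, siteMap_pureTensor, Function.update_self, Function.update_idem,
        h.apply_eq j (x m) _ (LinearPMap.mem_graph A ⟨x m, hx⟩)]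
    exact fun p hp => hS hp
  -- Closability: if the first component vanishes, every cutoff of the second vanishes, and these
  -- converge to it. Only then is the closure known to be the graph of `siteOp`.
  have hfun : ∀ p ∈ G.topologicalClosure, p.1 = 0 → p.2 = 0 := by
    intro p hp h0
    refine tendsto_nhds_unique (tendsto_siteMap h.norm_le h.tendsto m p.2) ?_
    simp only [hcut _ p hp, h0, map_zero]
    exact tendsto_const_nhds
  rw [siteOp, ← hG, Submodule.toLinearPMap_graph_eq _ hfun]
  let f : TensorPower H n →L[ℂ] TensorPower H n × TensorPower H n :=
    (siteMap (P k) m).prod (siteMap (W k) m)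
  have htop : G.topologicalClosure.comap f.toLinearMap = ⊤ := by
    refine tensorPower_eq_top (G.isClosed_topologicalClosure.preimage f.continuous) fun x => ?_
    refine Submodule.le_topologicalClosure _ (Submodule.subset_span ?_)
    obtain ⟨hx, hAx⟩ := exists_eq_of_mem_graph (h.mem_graph k (x m))
    refine ⟨Function.update x m (P k (x m)), by rwa [Function.update_self], ?_⟩
    change (siteMap (P k) m (pureTensor n x), siteMap (W k) m (pureTensor n x)) = _
    rw [siteMap_pureTensor, siteMap_pureTensor, Function.update_idem]
    simp only [Function.update_self, hAx]
  exact (htop ▸ Submodule.mem_top : ψ ∈ G.topologicalClosure.comap f.toLinearMap)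

/-- The bounded mean field operator `M⁻¹ ∑_m W^{[m]}`. -/
def meanMap (W : H →L[ℂ] H) (M : ℕ) : TensorPower H M →L[ℂ] TensorPower H M :=
  (M : ℂ)⁻¹ • ∑ m : Fin M, siteMap W m

/-- The prefactor cancels the number of sites, which is the source of uniformity in `M`. -/
lemma norm_meanMap_le (W : H →L[ℂ] H) (M : ℕ) : ‖meanMap W M‖ ≤ ‖W‖ := by
  have h : ‖∑ m : Fin M, siteMap W m‖ ≤ M * ‖W‖ := by
    refine (norm_sum_le _ _).trans ((Finset.sum_le_sum fun m _ => norm_siteMap_le W m).trans ?_)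
    simp
  rw [meanMap, norm_smul, norm_inv, Complex.norm_natCast]
  rcases Nat.eq_zero_or_pos M with rfl | hM
  · simp
  · rw [inv_mul_le_iff₀ (by exact_mod_cast hM)]
    exact h

lemma IsCutoff.mem_graph_meanField {A : H →ₗ.[ℂ] H} {P W : ℕ → H →L[ℂ] H} (h : IsCutoff A P W)
    {k : ℕ} (hP : (P k).comp (P k) = P k) {M : ℕ} {ψ : TensorPower H M}
    (hψ : tensorMap (P k) M ψ = ψ) : (ψ, meanMap (W k) M ψ) ∈ (meanField A M).graph := by
  have hsum : (ψ, ∑ m : Fin M, siteMap (W k) m ψ) ∈ (∑ m : Fin M, siteOp A m).graph := by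
    refine mem_graph_sum _ fun m _ => ?_
    have hm := h.mem_graph_siteOp m k ψ
    rwa [← hψ, siteMap_tensorMap hP, hψ] at hm
  simpa [meanMap, meanField] using mem_graph_smul (M : ℂ)⁻¹ hsum

lemma tensorMap_meanMap {P W : H →L[ℂ] H} (h₁ : P.comp W = W) (h₂ : W.comp P = W)
    {M : ℕ} (ψ : TensorPower H M) :
    tensorMap P M (meanMap W M ψ) = meanMap W M (tensorMap P M ψ) := by
  simp [meanMap, tensorMap_siteMap h₁ h₂]

end SiteOp

/-! ### Truncated block-diagonal operators on Hilbert sums -/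

section Cutoff

variable {E : ℕ → Type} [∀ n, NormedAddCommGroup (E n)] [∀ n, InnerProductSpace ℂ (E n)]

/-- A crude bound, serving only to define `cutoff`; the useful one is `norm_cutoff_le`. -/
lemma norm_ite_le_sum (B : ∀ n, E n →L[ℂ] E n) (k n : ℕ) :
    ‖(if n ≤ k then B n else 0)‖ ≤ ∑ j ∈ Finset.range (k + 1), ‖B j‖ := by
  split_ifs with h
  · exact Finset.single_le_sum (f := fun j => ‖B j‖) (fun _ _ => norm_nonneg _)
      (Finset.mem_range.2 (Nat.lt_succ_of_le h))
  · simpa using Finset.sum_nonneg fun j _ => norm_nonneg (B j)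

/-- The bounded operator that acts by `B n` on the `n`-th summand if `n ≤ k`, and by zero
otherwise. -/
def cutoff (B : ∀ n, E n →L[ℂ] E n) (k : ℕ) : lp E 2 →L[ℂ] lp E 2 :=
  lp.mapCLM 2 (fun n => if n ≤ k then B n else 0)
    (Finset.sum_nonneg fun j _ => norm_nonneg (B j)) (norm_ite_le_sum B k)

lemma cutoff_apply (B : ∀ n, E n →L[ℂ] E n) (k : ℕ) (x : lp E 2) (n : ℕ) :
    cutoff B k x n = if n ≤ k then B n (x n) else 0 := by
  change (if n ≤ k then B n else 0) (x n) = _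
  split_ifs <;> rfl

lemma norm_cutoff_le {B : ∀ n, E n →L[ℂ] E n} {k : ℕ} {C : ℝ} (hC : 0 ≤ C)
    (h : ∀ n ≤ k, ‖B n‖ ≤ C) : ‖cutoff B k‖ ≤ C := by
  have hB : ∀ n, ‖(if n ≤ k then B n else 0)‖ ≤ C := fun n => by
    split_ifs with hn
    · exact h n hn
    · simpa using hC
  exact lp.norm_mapCLM_le 2 _ hC hB

lemma cutoff_comp_cutoff (A B : ∀ n, E n →L[ℂ] E n) (k : ℕ) :
    (cutoff A k).comp (cutoff B k) = cutoff (fun n => (A n).comp (B n)) k := by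
  ext x n
  simp only [ContinuousLinearMap.comp_apply, cutoff_apply]
  split_ifs <;> rfl

lemma tendsto_cutoff_id (x : lp E 2) :
    Filter.Tendsto (fun k => cutoff (fun n => ContinuousLinearMap.id ℂ (E n)) k x) Filter.atTop
      (nhds x) := by
  -- The cutoff at `k` keeps the `k + 1` summands `0, …, k`, hence the shift of the partial sums.
  have h := ((lp.hasSum_single (E := E) (p := 2) (by simp) x).tendsto_sum_nat).comp
    (Filter.tendsto_add_atTop_nat 1)
  convert! h using 2 with k
  ext n
  rw [cutoff_apply, Function.comp_apply, lp.coeFn_sum, Finset.sum_apply]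
  split_ifs with hn
  · rw [Finset.sum_eq_single n]
    · simp
    · intro j _ hj
      exact lp.single_apply_ne _ _ _ hj.symm
    · intro hn'
      exact absurd (Finset.mem_range.2 (Nat.lt_succ_of_le hn)) hn'
  · refine (Finset.sum_eq_zero fun j hj => lp.single_apply_ne _ _ _ ?_).symm
    rintro rfl
    exact hn (Nat.le_of_lt_succ (Finset.mem_range.1 hj))

lemma norm_inv_smul_le {B : ∀ n, E n →L[ℂ] E n} {C : ℝ} (hB : ∀ n, ‖B n‖ ≤ ((n : ℝ) + 1) * C) (n : ℕ) : ‖((n : ℂ) + 1)⁻¹ • B n‖ ≤ C := by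
  have hn : ‖(n : ℂ) + 1‖ = (n : ℝ) + 1 := by
    exact_mod_cast Complex.norm_natCast (n + 1)
  rw [norm_smul, norm_inv, hn, inv_mul_le_iff₀ (by positivity)]
  exact hB n

end Cutoff

/-! ### Fock space operators sector by sector -/

section FockOperators

variable {h : Type} [NormedAddCommGroup h] [InnerProductSpace ℂ h]

lemma mem_graph_maxOp {L : (∀ n, Sector h n) →ₗ[ℂ] (∀ n, Sector h n)} {x y : Fock h} :
    (x, y) ∈ (maxOp L).graph ↔ ∀ n, y n = L x n := by
  rw [LinearPMap.mem_graph_iff]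
  constructor
  · rintro ⟨u, rfl, rfl⟩ n
    rfl
  · intro hy
    have hL : L x = y := funext fun n => (hy n).symm
    refine ⟨⟨x, ?_⟩, rfl, ?_⟩
    · change Memℓp (L x) 2
      rw [hL]
      exact lp.memℓp y
    · exact Subtype.ext hL

lemma mem_graph_number {x y : Fock h} :
    (x, y) ∈ (number : Fock h →ₗ.[ℂ] Fock h).graph ↔ ∀ n, y n = (n : ℂ) • x n :=
  mem_graph_maxOp

lemma mem_graph_create {f : h} {x y : Fock h} :
    (x, y) ∈ (create f).graph ↔ y 0 = 0 ∧ ∀ n, y (n + 1) = createSector f n (x n) :=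
  mem_graph_maxOp.trans ⟨fun H => ⟨H 0, fun n => H (n + 1)⟩,
    fun H n => match n with
      | 0 => H.1
      | n + 1 => H.2 n⟩

lemma mem_graph_annihilate {f : h} {x y : Fock h} :
    (x, y) ∈ (annihilate f).graph ↔ ∀ n, y n = annihilateSector f n (x (n + 1)) :=
  mem_graph_maxOp

/-- `Γ(U)` on the `n`-particle space. -/
def quantizationSector (U : h →L[ℂ] h) (n : ℕ) : Sector h n →L[ℂ] Sector h n :=
  ((symSubspace h n).orthogonalProjectionOnto.comp (tensorMap U n)).comp (symSubspace h n).subtypeL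

lemma mem_graph_secondQuantization {U : h →L[ℂ] h} {x y : Fock h} :
    (x, y) ∈ (secondQuantization U).graph ↔ ∀ n, y n = quantizationSector U n (x n) :=
  mem_graph_maxOp

lemma norm_quantizationSector_le {U : h →L[ℂ] h} (hU : ‖U‖ ≤ 1) (n : ℕ) :
    ‖quantizationSector U n‖ ≤ 1 := by
  refine ContinuousLinearMap.opNorm_le_bound _ zero_le_one fun ψ => ?_
  rw [one_mul]
  refine ((symSubspace h n).norm_orthogonalProjectionOnto_apply_le _).trans ?_
  exact (ContinuousLinearMap.le_of_opNorm_le _ (norm_tensorMap_le_one hU n) _).trans_eq (one_mul _)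

lemma norm_tensorCons (f : h) (n : ℕ) (ψ : TensorPower h n) : ‖tensorCons f n ψ‖ = ‖f‖ * ‖ψ‖ :=
  (UniformSpace.Completion.norm_coe (f ⊗ₜ[ℂ] ψ)).trans (TensorProduct.norm_tmul f ψ)

lemma norm_createSector_le (f : h) (n : ℕ) :
    ‖createSector f n‖ ≤ Real.sqrt (n + 1) * ‖f‖ := by
  refine ContinuousLinearMap.opNorm_le_bound _ (by positivity) fun ψ => ?_
  change ‖((Real.sqrt (n + 1) : ℝ) : ℂ) •
    (symSubspace h (n + 1)).orthogonalProjectionOnto (tensorCons f n ψ)‖ ≤ _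
  rw [norm_smul, Complex.norm_real, Real.norm_of_nonneg (Real.sqrt_nonneg _), mul_assoc]
  refine mul_le_mul_of_nonneg_left ?_ (Real.sqrt_nonneg _)
  refine ((symSubspace h (n + 1)).norm_orthogonalProjectionOnto_apply_le _).trans ?_
  exact (norm_tensorCons f n ψ).le

lemma norm_annihilateSector_le (f : h) (n : ℕ) :
    ‖annihilateSector f n‖ ≤ Real.sqrt (n + 1) * ‖f‖ := by
  rw [annihilateSector, LinearIsometryEquiv.norm_map]
  exact norm_createSector_le f n

/-- `a†(g) a(g)` on the `n`-particle space. -/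
def scatteringSector (g : h) : (n : ℕ) → Sector h n →L[ℂ] Sector h n
  | 0 => 0
  | n + 1 => (createSector g n).comp (annihilateSector g n)

lemma norm_scatteringSector_le (g : h) : ∀ n : ℕ, ‖scatteringSector g n‖ ≤ n * ‖g‖ ^ 2
  | 0 => by
    rw [Nat.cast_zero, zero_mul]
    exact (ContinuousLinearMap.opNorm_zero (E := Sector h 0) (F := Sector h 0)).le
  | n + 1 => by
    refine (ContinuousLinearMap.opNorm_comp_le _ _).trans ?_
    refine (mul_le_mul (norm_createSector_le g n) (norm_annihilateSector_le g n)
      (ContinuousLinearMap.opNorm_nonneg _) (by positivity)).trans_eq ?_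
    have := Real.mul_self_sqrt (show (0 : ℝ) ≤ n + 1 by positivity)
    push_cast
    linear_combination ‖g‖ ^ 2 * this

lemma apply_eq_of_mem_graph_scattering {g : h} {x y : Fock h}
    (hxy : (x, y) ∈ (scattering g).graph) (n : ℕ) : y n = scatteringSector g n (x n) := by
  obtain ⟨z, hxz, hzy⟩ := mem_graph_opMul.1 hxy
  rw [mem_graph_annihilate] at hxz
  rw [mem_graph_create] at hzy
  cases n with
  | zero => exact hzy.1
  | succ n =>
    rw [hzy.2, hxz]
    rfl

/-- The vector `ψ = (N + 1) x` certifies that `x` lies in the domain of the number operator, which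
makes the intermediate vector `a(g) x` square summable. -/
lemma mem_graph_scattering {g : h} {x y ψ : Fock h} (hψ : ∀ n, ψ n = ((n : ℂ) + 1) • x n)
    (hy : ∀ n, y n = scatteringSector g n (x n)) : (x, y) ∈ (scattering g).graph := by
  have hz : Memℓp (fun n => annihilateSector g n (x (n + 1))) 2 := by
    refine memℓp_gen ?_
    have hs := ((lp.memℓp ψ).summable (by simp)).comp_injective (add_left_injective 1)
    simp only [ENNReal.toReal_ofNat, Real.rpow_ofNat] at hs ⊢
    refine .of_nonneg_of_le (fun _ => by positivity) (fun n => ?_) (hs.mul_left (‖g‖ ^ 2))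
    rw [Function.comp_apply, ← mul_pow]
    gcongr
    refine (ContinuousLinearMap.le_of_opNorm_le _ (norm_annihilateSector_le g n) _).trans ?_
    have hn : ‖((n + 1 : ℕ) : ℂ) + 1‖ = (n : ℝ) + 2 := by
      rw [show ((n + 1 : ℕ) : ℂ) + 1 = ((n + 2 : ℕ) : ℂ) by push_cast; ring,
        Complex.norm_natCast]
      push_cast
      rfl
    rw [hψ, norm_smul, hn]
    have hsq : Real.sqrt (n + 1) ≤ n + 2 := by
      rw [Real.sqrt_le_iff]
      have : (0 : ℝ) ≤ n := Nat.cast_nonneg n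
      exact ⟨by positivity, by nlinarith⟩
    calc Real.sqrt (n + 1) * ‖g‖ * ‖x (n + 1)‖ ≤ (n + 2) * ‖g‖ * ‖x (n + 1)‖ := by gcongr
      _ = ‖g‖ * ((n + 2) * ‖x (n + 1)‖) := by ring
  refine mem_graph_opMul.2 ⟨⟨_, hz⟩, mem_graph_annihilate.2 fun n => rfl,
    mem_graph_create.2 ⟨hy 0, fun n => hy (n + 1)⟩⟩

/-- Injectivity is what gives `LinearPMap.inverse` its meaning. -/
lemma ker_number_add_one :
    LinearMap.ker (number + opOne : Fock h →ₗ.[ℂ] Fock h).toFun = ⊥ := by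
  refine LinearMap.ker_eq_bot'.2 fun x hx => Subtype.ext (lp.ext (funext fun n => ?_))
  have h₁ : (x.1, number ⟨x.1, x.2.1⟩) ∈ (number : Fock h →ₗ.[ℂ] Fock h).graph :=
    LinearPMap.mem_graph number ⟨x.1, x.2.1⟩
  have h₂ : number ⟨x.1, x.2.1⟩ + x.1 = 0 := hx
  have h₃ : number ⟨x.1, x.2.1⟩ n + x.1 n = 0 := congrArg (fun y : Fock h => y n) h₂
  rw [mem_graph_number.1 h₁ n] at h₃
  have h₄ : ((n : ℂ) + 1) • x.1 n = 0 := by rw [add_smul, one_smul, h₃]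
  exact (smul_eq_zero.1 h₄).resolve_left (Nat.cast_add_one_ne_zero n)

lemma mem_graph_inverse_number_add_one {φ ψ : Fock h} (hψ : ∀ n, ψ n = ((n : ℂ) + 1) • φ n) :
    (ψ, φ) ∈ (number + opOne : Fock h →ₗ.[ℂ] Fock h).inverse.graph := by
  have h₁ : (φ, (ψ - φ) + φ) ∈ (number + opOne : Fock h →ₗ.[ℂ] Fock h).graph := by
    refine mem_graph_add (mem_graph_number.2 fun n => ?_) (mem_graph_opOne.2 rfl)
    rw [lp.coeFn_sub, Pi.sub_apply, hψ, add_smul, one_smul, add_sub_cancel_right]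
  rw [sub_add_cancel] at h₁
  obtain ⟨hφ, hval⟩ := exists_eq_of_mem_graph h₁
  have h₂ := LinearPMap.mem_inverse_graph ker_number_add_one ⟨φ, hφ⟩
  rwa [hval] at h₂

theorem isBoundedBy_scattering_inverse_number (g : h) :
    IsBoundedBy (opMul (scattering g) (number + opOne : Fock h →ₗ.[ℂ] Fock h).inverse)
      (‖g‖ ^ 2) := by
  intro ψ
  have hid : ∀ n : ℕ, ‖ContinuousLinearMap.id ℂ (Sector h n)‖ ≤ ((n : ℝ) + 1) * 1 := fun n =>
    ContinuousLinearMap.norm_id_le.trans (by rw [mul_one]; exact le_add_of_nonneg_left n.cast_nonneg)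
  have hB : ∀ n : ℕ, ‖scatteringSector g n‖ ≤ ((n : ℝ) + 1) * ‖g‖ ^ 2 := fun n =>
    (norm_scatteringSector_le g n).trans (by gcongr; simp)
  let φ : Fock h := lp.mapCLM 2 _ zero_le_one (norm_inv_smul_le hid) ψ
  let T : Fock h →L[ℂ] Fock h :=
    lp.mapCLM 2 _ (sq_nonneg ‖g‖) (norm_inv_smul_le hB)
  have hφ : ∀ n, φ n = ((n : ℂ) + 1)⁻¹ • ψ n := fun n => rfl
  have hψ : ∀ n, ψ n = ((n : ℂ) + 1) • φ n := fun n => by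
    rw [hφ, smul_smul, mul_inv_cancel₀ (Nat.cast_add_one_ne_zero n), one_smul]
  have hT : ∀ n, T ψ n = scatteringSector g n (φ n) := fun n => by
    rw [hφ, map_smul]
    rfl
  obtain ⟨hx, hval⟩ := exists_eq_of_mem_graph (mem_graph_opMul.2
    ⟨φ, mem_graph_inverse_number_add_one hψ, mem_graph_scattering hψ hT⟩)
  refine ⟨hx, ?_⟩
  rw [hval]
  exact T.le_of_opNorm_le (lp.norm_mapCLM_le 2 _ _ _) ψ

/-- The truncation to at most `k` particles. -/
abbrev truncation (h : Type) [NormedAddCommGroup h] [InnerProductSpace ℂ h] (k : ℕ) :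
    Fock h →L[ℂ] Fock h :=
  cutoff (fun n => ContinuousLinearMap.id ℂ (Sector h n)) k

lemma truncation_comp_cutoff (B : ∀ n, Sector h n →L[ℂ] Sector h n) (k : ℕ) :
    (truncation h k).comp (cutoff B k) = cutoff B k :=
  cutoff_comp_cutoff _ _ _

lemma cutoff_comp_truncation (B : ∀ n, Sector h n →L[ℂ] Sector h n) (k : ℕ) :
    (cutoff B k).comp (truncation h k) = cutoff B k :=
  cutoff_comp_cutoff _ _ _

/-- `Γ(U) a†(g) a(g) Γ(V)` on the `n`-particle space. -/
def conjSector (U V : h →L[ℂ] h) (g : h) (n : ℕ) : Sector h n →L[ℂ] Sector h n :=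
  (quantizationSector U n).comp ((scatteringSector g n).comp (quantizationSector V n))

lemma norm_conjSector_le {U V : h →L[ℂ] h} (hU : ‖U‖ ≤ 1) (hV : ‖V‖ ≤ 1) (g : h) (n : ℕ) :
    ‖conjSector U V g n‖ ≤ n * ‖g‖ ^ 2 := by
  calc ‖conjSector U V g n‖
      ≤ ‖quantizationSector U n‖ * (‖scatteringSector g n‖ * ‖quantizationSector V n‖) :=
        (ContinuousLinearMap.opNorm_comp_le _ _).trans
          (mul_le_mul_of_nonneg_left (ContinuousLinearMap.opNorm_comp_le _ _) (norm_nonneg _))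
    _ ≤ 1 * (n * ‖g‖ ^ 2 * 1) := by
        gcongr
        · exact norm_quantizationSector_le hU n
        · exact norm_scatteringSector_le g n
        · exact norm_quantizationSector_le hV n
    _ = n * ‖g‖ ^ 2 := by ring

/-- All factors act within sectors, so they commute with truncation, and finitely many sectors raise
no domain question. -/
lemma isCutoff_conj (U V : h →L[ℂ] h) (g : h) :
    IsCutoff (opMul (secondQuantization U) (opMul (scattering g) (secondQuantization V)))
      (truncation h) (cutoff (conjSector U V g)) where
  norm_le k := norm_cutoff_le zero_le_one fun _ _ => ContinuousLinearMap.norm_id_le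
  tendsto x := tendsto_cutoff_id x
  mem_graph k x := by
    refine mem_graph_opMul.2 ⟨cutoff (fun n => (scatteringSector g n).comp
      (quantizationSector V n)) k x, mem_graph_opMul.2 ⟨cutoff (quantizationSector V) k x,
        mem_graph_secondQuantization.2 fun n => ?_, mem_graph_scattering
        -- The witness is `(N + 1) Γ(V)` applied to the truncated vector.
        (ψ := cutoff (fun n => ((n : ℂ) + 1) • quantizationSector V n) k x)
        (fun n => ?_) fun n => ?_⟩, mem_graph_secondQuantization.2 fun n => ?_⟩ <;>
    · simp only [cutoff_apply]
      split_ifs <;> simp [conjSector]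
  apply_eq k x y hxy := by
    obtain ⟨w, hw, hwy⟩ := mem_graph_opMul.1 hxy
    obtain ⟨z, hxz, hzw⟩ := mem_graph_opMul.1 hw
    ext1
    ext1 n
    rw [cutoff_apply, cutoff_apply]
    split_ifs
    · rw [mem_graph_secondQuantization.1 hwy, apply_eq_of_mem_graph_scattering hzw,
        mem_graph_secondQuantization.1 hxz]
      rfl
    · rfl

end FockOperators

/-! ### A basis adapted to the particle number -/

section Support

variable {E : ℕ → Type} [∀ n, NormedAddCommGroup (E n)] [∀ n, InnerProductSpace ℂ (E n)]
  [∀ n, CompleteSpace (E n)]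

/-- A Hilbert sum has a Hilbert basis each of whose members lies in one of the summands. -/
lemma exists_hilbertBasis_single : ∃ (s : Set (lp E 2)) (b : HilbertBasis s ℂ (lp E 2)),
    ∀ i, ∃ (n : ℕ) (y : E n), b i = lp.single 2 n y := by
  choose w e he using fun n => exists_hilbertBasis ℂ (E n)
  let v : (Σ n, w n) → lp E 2 := fun p => lp.single 2 p.1 (e p.1 p.2)
  have hv : Orthonormal ℂ v := by
    refine ⟨fun p => ?_, ?_⟩
    · rw [lp.norm_single (by simp)]
      exact (e p.1).orthonormal.norm_eq_one p.2
    · rintro ⟨n, i⟩ ⟨m, j⟩ hij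
      rw [lp.inner_single_left]
      rcases eq_or_ne n m with rfl | hnm
      · rw [lp.single_apply_self]
        refine (e n).orthonormal.inner_eq_zero fun h => hij ?_
        exact congrArg (Sigma.mk n) h
      · rw [lp.single_apply_ne _ _ _ hnm, inner_zero_right]
  have hbot : (Submodule.span ℂ (Set.range ((↑) : Set.range v → lp E 2)))ᗮ = ⊥ := by
    rw [Subtype.range_coe, Submodule.eq_bot_iff]
    intro x hx
    ext n
    refine (e n).repr.map_eq_zero_iff.1 (lp.ext (funext fun i => ?_))
    have h := (Submodule.mem_orthogonal _ _).1 hx (v ⟨n, i⟩) (Submodule.subset_span ⟨_, rfl⟩)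
    rw [lp.inner_single_left] at h
    rwa [(e n).repr_apply_apply]
  refine ⟨Set.range v, HilbertBasis.mkOfOrthogonalEqBot hv.toSubtypeRange hbot, ?_⟩
  rintro ⟨-, p, rfl⟩
  exact ⟨p.1, e p.1 p.2, by rw [HilbertBasis.coe_mkOfOrthogonalEqBot]⟩

end Support

/-! ### Moment bounds confine the particle number -/

section Moments

variable {h : Type} [NormedAddCommGroup h] [InnerProductSpace ℂ h]

lemma apply_eq_of_mem_graph_opPow_number {k : ℕ} {x y : Fock h}
    (hxy : (x, y) ∈ (opPow number k).graph) (n : ℕ) : y n = (n : ℂ) ^ k • x n := by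
  induction k generalizing y with
  | zero =>
    rw [mem_graph_opOne.1 hxy, pow_zero, one_smul]
  | succ k ih =>
    obtain ⟨z, hxz, hzy⟩ := mem_graph_opMul.1 hxy
    rw [mem_graph_number.1 hzy, ih hxz, smul_smul, pow_succ']

/-- If all moments of the number operator are bounded by the powers of `c`, then there are almost
surely at most `c` particles. -/
lemma apply_eq_zero_of_moments_le {ρ : Fock h →L[ℂ] Fock h} (hρ : ρ.IsPositive) {c : ℝ}
    (hc : ∀ k : ℕ, ∃ x : ℝ, HasExpectation ρ (opPow number k) (x : ℂ) ∧ x ≤ c ^ k) :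
    0 ≤ c ∧ ∀ (x : Fock h) (n : ℕ), c < n → ρ x n = 0 := by
  -- In a basis of states with definite particle number, the `k`-th moment is the sum of `N i ^ k`
  -- against the nonnegative weights `⟪b i, ρ (b i)⟫`.
  obtain ⟨s, b, hb⟩ := exists_hilbertBasis_single (E := Sector h)
  choose N y hy using hb
  have hq0 : ∀ i, 0 ≤ (⟪b i, ρ (b i)⟫_ℂ).re := fun i => hρ.re_inner_nonneg_right (b i)
  have hsum : ∀ k : ℕ, ∃ a ≤ c ^ k,
      HasSum (fun i => (N i : ℝ) ^ k * (⟪b i, ρ (b i)⟫_ℂ).re) a := by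
    intro k
    obtain ⟨a, ⟨hdom, htr⟩, hle⟩ := hc k
    refine ⟨a, hle, ?_⟩
    have hre := (htr s b).mapL Complex.reCLM
    simp only [Complex.reCLM_apply, Complex.ofReal_re] at hre
    convert! hre using 2 with i
    have hval := apply_eq_of_mem_graph_opPow_number
      (LinearPMap.mem_graph (opPow number k) ⟨ρ (b i), hdom (b i)⟩) (N i)
    have hin : ⟪b i, opPow number k ⟨ρ (b i), hdom (b i)⟩⟫_ℂ =
        ((N i ^ k : ℝ) : ℂ) * ⟪b i, ρ (b i)⟫_ℂ := by
      conv_lhs => rw [hy i, lp.inner_single_left, ← hy i, hval, inner_smul_right]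
      conv_rhs => rw [hy i, lp.inner_single_left, ← hy i]
      push_cast
      rfl
    rw [hin, Complex.re_ofReal_mul]
  have hc0 : 0 ≤ c := by
    obtain ⟨a, hle, ha⟩ := hsum 1
    rw [pow_one] at hle
    exact (ha.nonneg fun i => mul_nonneg (by positivity) (hq0 i)).trans hle
  refine ⟨hc0, fun x n hn => ?_⟩
  have hzero : ∀ i, N i = n → ρ (b i) = 0 := by
    intro i hi
    have hn0 : (0 : ℝ) < n := hc0.trans_lt hn
    -- One term of the `k`-th moment is at most the whole sum, hence at most `c ^ k`.
    have hle : ∀ k : ℕ, (⟪b i, ρ (b i)⟫_ℂ).re ≤ (c / n) ^ k := fun k => by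
      obtain ⟨a, hle, ha⟩ := hsum k
      have := (le_hasSum ha i fun j _ => mul_nonneg (by positivity) (hq0 j)).trans hle
      rw [hi] at this
      rw [div_pow, le_div_iff₀ (by positivity), mul_comm]
      exact this
    have hlim := tendsto_pow_atTop_nhds_zero_of_lt_one (by positivity) ((div_lt_one hn0).2 hn)
    have hre : (⟪b i, ρ (b i)⟫_ℂ).re = 0 := (ge_of_tendsto' hlim hle).antisymm (hq0 i)
    refine apply_eq_zero_of_inner_eq_zero hρ (Complex.ext hre ?_)
    exact hρ.isSymmetric.im_inner_self_apply (b i)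
  -- Tested against `b i`, this is zero unless `N i = n`, and then it equals `⟪b i, ρ x⟫ = ⟪ρ (b i),
  -- x⟫ = 0`.
  have hsingle : lp.single 2 n (ρ x n) = (0 : Fock h) := by
    refine b.repr.map_eq_zero_iff.1 (lp.ext (funext fun i => ?_))
    rw [b.repr_apply_apply, lp.inner_single_right]
    rcases eq_or_ne (N i) n with hi | hi
    · have h₁ : ⟪b i, ρ x⟫_ℂ = 0 := by
        rw [← hρ.isSymmetric.apply_clm, hzero i hi, inner_zero_left]
      subst hi
      rw [hy i, lp.inner_single_left] at h₁
      rw [hy i, lp.single_apply_self]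
      exact h₁
    · rw [hy i, lp.single_apply_ne _ _ _ hi.symm, inner_zero_left]
      rfl
  have := congrArg (fun z : Fock h => z n) hsingle
  simpa using this

lemma truncation_comp_eq {ρ : Fock h →L[ℂ] Fock h} {c : ℝ} (hc : 0 ≤ c)
    (hρ : ∀ (x : Fock h) (n : ℕ), c < n → ρ x n = 0) :
    (truncation h ⌊c⌋₊).comp ρ = ρ := by
  ext1 x
  ext1
  ext1 n
  rw [ContinuousLinearMap.comp_apply, cutoff_apply]
  split_ifs with hn
  · rfl
  · rw [Nat.le_floor_iff hc, not_le] at hn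
    exact (hρ x n hn).symm

end Moments

/-! ### Uniform bound on the expectations -/

lemma norm_prod_ofFn_le {H : Type} [NormedAddCommGroup H] [NormedSpace ℂ H] {C : ℝ} (hC : 0 ≤ C) :
    ∀ {n : ℕ} {T : Fin n → H →L[ℂ] H}, (∀ i, ‖T i‖ ≤ C) → ‖(List.ofFn T).prod‖ ≤ C ^ n
  | 0, _, _ => by
    rw [List.ofFn_zero, List.prod_nil, pow_zero]
    exact ContinuousLinearMap.norm_id_le
  | n + 1, T, hT => by
    rw [List.ofFn_succ, List.prod_cons, pow_succ']
    exact (norm_mul_le _ _).trans (mul_le_mul (hT 0)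
      (norm_prod_ofFn_le hC fun i => hT i.succ) (norm_nonneg _) hC)

/-- Uniform moment bounds for mean fields of operators that have cutoffs which do not affect the
density matrix. -/
lemma reservoirBound_of_isCutoff {H : Type} [NormedAddCommGroup H] [InnerProductSpace ℂ H]
    [CompleteSpace H] {ρ : H →L[ℂ] H} (hρ : IsDensityMatrix ρ) {v : ℝ → H →ₗ.[ℂ] H}
    {P : ℕ → H →L[ℂ] H} {W : ℝ → ℕ → H →L[ℂ] H} (hv : ∀ t, IsCutoff (v t) P (W t)) {k : ℕ}
    (hPρ : (P k).comp ρ = ρ) (hPP : (P k).comp (P k) = P k)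
    (hPW : ∀ t, (P k).comp (W t k) = W t k) (hWP : ∀ t, (W t k).comp (P k) = W t k)
    {C : ℝ} (hC : 0 ≤ C) (hW : ∀ t, ‖W t k‖ ≤ C) :
    ReservoirBound (fun M => tensorMap ρ M) v (fun n => C ^ n) (fun _ => 1) := by
  intro n t _ M _
  obtain ⟨ι, u, hu⟩ := exists_isMixture hρ
  obtain ⟨κ, w, hw⟩ := hu.tensorMap M
  -- The vectors fixed by `P^{⊗M}`: they contain the range of `ρ^{⊗M}`, are invariant under the
  -- bounded mean fields, and lie in the domains of the unbounded ones.
  let S : Submodule ℂ (TensorPower H M) :=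
    LinearMap.eqLocus (tensorMap (P k) M).toLinearMap LinearMap.id
  let T : Fin n → (TensorPower H M →L[ℂ] TensorPower H M) := fun i => meanMap (W (t i) k) M
  have hprod := mem_graph_opProd_ofFn (S := S) (A := fun i => meanField (v (t i)) M) (T := T)
    (fun i ψ hψ => (hv (t i)).mem_graph_meanField hPP hψ)
    (fun i ψ hψ => (tensorMap_meanMap (hPW _) (hWP _) ψ).trans (congrArg (T i) hψ))
  have hmem : ∀ x, tensorMap ρ M x ∈ S := fun x => by
    change tensorMap (P k) M (tensorMap ρ M x) = tensorMap ρ M x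
    rw [tensorMap_tensorMap, hPρ]
  refine ⟨∑' j, ⟪w j, (List.ofFn T).prod (w j)⟫_ℂ,
    ⟨fun x => (exists_eq_of_mem_graph (hprod _ (hmem x)).1).1, ?_⟩, ?_⟩
  · have heq := fun x => (exists_eq_of_mem_graph (hprod _ (hmem x)).1).2
    simp only [heq]
    exact hw.hasTrace _
  · rw [Finset.prod_const_one, mul_one]
    exact (hw.norm_tsum_inner_le _).trans
      (norm_prod_ofFn_le hC fun i => (norm_meanMap_le _ M).trans (hW (t i)))

lemma norm_phase_le {d : ℕ} {θ : EuclideanSpace ℝ (Fin d) → ℝ} (hθ : Measurable θ) :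
    ‖phase θ hθ‖ ≤ 1 :=
  LinearMap.mkContinuous_norm_le _ zero_le_one _

lemma isCutoff_heisenberg_scattering {d : ℕ} (ω : EuclideanSpace ℝ (Fin d) → ℝ)
    (hω : Measurable ω) (g : OneParticle d) (t : ℝ) :
    IsCutoff (heisenberg ω hω (scattering g) t) (truncation (OneParticle d))
      (cutoff (conjSector (phase (fun k => t * ω k) (hω.const_mul t))
        (phase (fun k => -t * ω k) (hω.const_mul (-t))) g)) :=
  isCutoff_conj _ _ g

end MeanField

end

theorem mainTheorem9 (d : ℕ) (ω : EuclideanSpace ℝ (Fin d) → ℝ) (hω : Measurable ω)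
    (_hω0 : ∀ k, 0 ≤ ω k) (g : MeanField.OneParticle d) :
    MeanField.IsBoundedBy (MeanField.opMul (MeanField.scattering g)
      (MeanField.number + MeanField.opOne).inverse) (2 * ‖g‖ ^ 2) ∧
    ∀ (ρ : MeanField.Fock (MeanField.OneParticle d) →L[ℂ]
        MeanField.Fock (MeanField.OneParticle d)) (c : ℝ),
      MeanField.IsDensityMatrix ρ →
      (∀ k : ℕ, ∃ x : ℝ,
        MeanField.HasExpectation ρ (MeanField.opPow MeanField.number k) (x : ℂ) ∧ x ≤ c ^ k) →
      MeanField.ReservoirBound (fun M => MeanField.tensorMap ρ M)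
        (MeanField.heisenberg ω hω (MeanField.scattering g))
        (fun n => (2 * c * ‖g‖ ^ 2) ^ n) (fun _ => 1) := by
  refine ⟨fun ψ => ?_, fun ρ c hρ hc => ?_⟩
  · obtain ⟨hψ, hle⟩ := MeanField.isBoundedBy_scattering_inverse_number g ψ
    refine ⟨hψ, hle.trans ?_⟩
    nlinarith [mul_nonneg (sq_nonneg ‖g‖) (norm_nonneg ψ)]
  · obtain ⟨hc0, hsupp⟩ := MeanField.apply_eq_zero_of_moments_le hρ.1 hc
    refine MeanField.reservoirBound_of_isCutoff hρ
      (MeanField.isCutoff_heisenberg_scattering ω hω g)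
      (MeanField.truncation_comp_eq hc0 hsupp) (MeanField.truncation_comp_cutoff _ _)
      (fun t => MeanField.truncation_comp_cutoff _ _)
      (fun t => MeanField.cutoff_comp_truncation _ _) (by positivity) fun t => ?_
    refine MeanField.norm_cutoff_le (by positivity) fun n hn => ?_
    refine (MeanField.norm_conjSector_le (MeanField.norm_phase_le _)
      (MeanField.norm_phase_le _) g n).trans ?_
    -- Sectors up to `⌊c⌋₊` already give `c ‖g‖²`; the factor 2 is slack.
    have hnc : (n : ℝ) ≤ c := (Nat.le_floor_iff hc0).1 hn
    gcongr
    linarith
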